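/- Let $n,r\ge 1$, let $D\subseteq\mathbb Z/n$ be a set of at least two possible delays, and let $\pi_d(i)=i+d$ be the cyclic shift of $\mathbb Z/n$ by $d$. Let $P$ be a probability distribution on $[r]=\{1,\dots,r\}$ and $W$ a channel (stochastic matrix) from $[r]$ to $[r]$. The sequence $\mathbf X\in[r]^n$ is i.i.d. with law $P$, $\tilde{\mathbf Y}$ is the output of the memoryless channel $W$ with input $\mathbf X$, the delay $d$ is uniform on $D$ and independent of $(\mathbf X,\tilde{\mathbf Y})$, and the received sequence is $Y_i=\tilde Y_{\pi_d(i)}$. A decoder $\Phi$ estimates $d$ from $(\mathbf X,\mathbf Y)$, and $P_e(\Phi)$ is the probability that its estimate differs from $d$. The maximum likelihood decoder $\Phi_{\mathrm{ML}}$ outputs a maximizer over $e\in D$ of $\prod_i W(Y_{\pi_e^{-1}(i)}\mid X_i)$, and the max mutual information decoder $\Phi_{\mathrm{MMI}}$ outputs a maximizer over $e\in D$ of the empirical mutual information $\hat I(\mathbf X;\mathbf Y_{\pi_e^{-1}})$ of the pairs $(X_i,Y_{\pi_e^{-1}(i)})$, ties being broken arbitrarily in both. Let $\kappa$ be the maximum,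 over distinct $d,e\in D$, of the number of permutation cycles of $\pi_d^{-1}\circ\pi_e$ (if $D$ is a subgroup of $\mathbb Z/n$, this is the maximum of the number of cycles of $\pi_d$ over $d\in D\setminus\{0\}$). Then $P_e(\Phi_{\mathrm{MMI}})>0$, $P_e(\Phi_{\mathrm{ML}})>0$, and $$0\le \frac1n\left[\log_2 P_e(\Phi_{\mathrm{MMI}})-\log_2 P_e(\Phi_{\mathrm{ML}})\right]\le \frac{\kappa}{n}\,r^2(r+2)\log_2\!\left(1+\frac n\kappa\right)+r^3\,\frac{\log_2(1+n)}{n}+\frac1n\log_2\kappa .$$ In particular the gap is $O(\kappa\log n/n)$: there is a constant $C>0$ depending only on $r$ such that the middle term is at most $C\,\kappa\log_2 n/n$ for all $n$, $D$, $P$, $W$ and all choices of the two decoders. -/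

import Mathlib

namespace DelayEstimation

noncomputable section

/-- A sequence of `n` symbols from the alphabet `[r]`, with cyclically indexed positions. -/
abbrev Sequence (n r : ℕ) : Type := ZMod n → Fin r

/-- The cyclic shift `i ↦ i + d`, as a permutation of the `n` positions. -/
def shift {n : ℕ} (d : ZMod n) : Equiv.Perm (ZMod n) := Equiv.addRight d

/-- The sequence transformed by a permutation `π`: its `i`-th symbol is `y (π i)`. -/
def transform {n r : ℕ} (π : Equiv.Perm (ZMod n)) (y : Sequence n r) : Sequence n r :=
  fun i => y (π i)

/-- The number of cycles of a permutation, fixed points counting as cycles of length one. -/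
def numCycles {α : Type*} (π : Equiv.Perm α) : ℕ :=
  Nat.card (Quotient (Equiv.Perm.SameCycle.setoid π))

/-- The maximum number `κ` of permutation cycles for the set `D` of possible delays: the maximum
of the number of cycles of `π_d⁻¹ ∘ π_e`, over the pairs of distinct possible delays `d`, `e`.
When `D` is a group this is the maximum over the nontrivial delays in `D`, see
`maxCycles_of_addSubgroup`. -/
def maxCycles {n : ℕ} (D : Finset (ZMod n)) : ℕ :=
  D.offDiag.sup fun p => numCycles ((shift p.1)⁻¹ * shift p.2)

theorem shift_inv_mul_shift {n : ℕ} (d e : ZMod n) :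
    (shift d)⁻¹ * shift e = shift (e - d) := by
  ext i
  simp [shift, sub_eq_add_neg, add_assoc]

theorem maxCycles_of_addSubgroup {n : ℕ} (H : AddSubgroup (ZMod n)) (D : Finset (ZMod n))
    (hD : ∀ d, d ∈ D ↔ d ∈ H) :
    maxCycles D = (D.erase 0).sup fun d => numCycles (shift d) := by
  apply le_antisymm
  · refine Finset.sup_le fun p hp => ?_
    rw [Finset.mem_offDiag, hD, hD] at hp
    rw [shift_inv_mul_shift]
    refine Finset.le_sup (f := fun d => numCycles (shift d)) (b := p.2 - p.1) ?_
    rw [Finset.mem_erase, hD]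
    exact ⟨sub_ne_zero.mpr hp.2.2.symm, H.sub_mem hp.2.1 hp.1⟩
  · refine Finset.sup_le fun d hd => ?_
    rw [Finset.mem_erase, hD] at hd
    have h := Finset.le_sup (f := fun p : ZMod n × ZMod n =>
      numCycles ((shift p.1)⁻¹ * shift p.2)) (s := D.offDiag) (b := (0, d))
      (by rw [Finset.mem_offDiag, hD, hD]; exact ⟨H.zero_mem, hd.2, hd.1.symm⟩)
    simp only [shift_inv_mul_shift, sub_zero] at h
    simpa only [maxCycles, shift_inv_mul_shift] using h

/-- The joint type (empirical distribution) of two sequences. -/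
def jointType {n r : ℕ} [NeZero n] (x y : Sequence n r) (a b : Fin r) : ℝ :=
  ((Finset.univ.filter fun i => x i = a ∧ y i = b).card : ℝ) / n

/-- The type (empirical distribution) of a sequence. -/
def seqType {n r : ℕ} [NeZero n] (x : Sequence n r) (a : Fin r) : ℝ :=
  ((Finset.univ.filter fun i => x i = a).card : ℝ) / n

/-- The empirical mutual information `Î(X;Y)`, in bits; terms with `jointType x y a b = 0`
vanish, which is the usual convention. -/
def empiricalMI {n r : ℕ} [NeZero n] (x y : Sequence n r) : ℝ :=
  ∑ a, ∑ b, jointType x y a b * Real.logb 2 (jointType x y a b / (seqType x a * seqType y b))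

/-- The probability of observing `y` when `x` is sent over the memoryless channel `W`, where
`W a b` is the probability of the output `b` given the input `a`. -/
def channelProb {n r : ℕ} [NeZero n] (W : Fin r → Fin r → ℝ) (x y : Sequence n r) : ℝ :=
  ∏ i, W (x i) (y i)

/-- The probability of `x` under the i.i.d. source with marginal `P`. -/
def sourceProb {n r : ℕ} [NeZero n] (P : Fin r → ℝ) (x : Sequence n r) : ℝ :=
  ∏ i, P (x i)

/-- A decoder maps the pair (source sequence, received sequence) to an estimate of the delay. -/
abbrev Decoder (n r : ℕ) : Type := Sequence n r → Sequence n r → ZMod n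

/-- `Φ` is a maximum likelihood decoder for the channel `W` over the set `D` of possible delays:
its estimate maximizes the likelihood of the realigned received sequence (ties are broken
arbitrarily). -/
def IsML {n r : ℕ} [NeZero n] (W : Fin r → Fin r → ℝ) (D : Finset (ZMod n))
    (Φ : Decoder n r) : Prop :=
  ∀ x y, Φ x y ∈ D ∧ ∀ d ∈ D,
    channelProb W x (transform (shift d)⁻¹ y) ≤ channelProb W x (transform (shift (Φ x y))⁻¹ y)

/-- `Φ` is a max mutual information decoder over the set `D` of possible delays: its estimate
maximizes the empirical mutual information between the source sequence and the realigned received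
sequence (ties are broken arbitrarily). -/
def IsMMI {n r : ℕ} [NeZero n] (D : Finset (ZMod n)) (Φ : Decoder n r) : Prop :=
  ∀ x y, Φ x y ∈ D ∧ ∀ d ∈ D,
    empiricalMI x (transform (shift d)⁻¹ y) ≤ empiricalMI x (transform (shift (Φ x y))⁻¹ y)

/-- The error probability of `Φ`: the delay `d` is uniform on `D`, independent of everything else,
`x` is drawn from the i.i.d. source, `z` is the output of the channel with input `x`, the received
sequence is `z` shifted by `d`, and the decoder errs when its estimate is not `d`. -/
def errorProb {n r : ℕ} [NeZero n] (P : Fin r → ℝ) (W : Fin r → Fin r → ℝ)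
    (D : Finset (ZMod n)) (Φ : Decoder n r) : ℝ :=
  ∑ d ∈ D, (1 / (D.card : ℝ)) *
    ∑ x : Sequence n r, ∑ z : Sequence n r,
      sourceProb P x * channelProb W x z *
        if Φ x (transform (shift d) z) ≠ d then 1 else 0

end

end DelayEstimation

/-!
The easy half is that the maximum likelihood decoder minimizes the error probability, and that the
error probability of every decoder is positive since constant sequences reveal nothing about the
delay. The rest is a comparison in the other direction, `errorProb_MMI_le`.

By a union bound over pairs of delays `d ≠ e` in `D` it suffices to compare, for the single shift
`σ` by `d - e`, the probability that `Î(x; z ∘ σ) ≥ Î(x; z)` with the overlap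
`∑ P(x) min (W(z | x)) (W(z ∘ σ | x))`, which bounds `|D|` times the error probability of any
decoder from below (`sum_overlap_le`). This comparison is `sum_confusion_le`. Both sides are related
to `T = ∑ ∏ᵢ V(xᵢ, zᵢ) V(xᵢ, z_{σ i})` with `V = √(P W)`. As `σ` consists of `c` cycles of a common
length `ℓ`, such sums are `tr(M ^ ℓ) ^ c` for a transfer matrix `M` (`sum_sum_prod_shift`); here
`M = Vᵀ V` is positive semidefinite.

*Upper bound for the confusion probability by `T`.* Let `Q` and `Q'` be the joint types of `(x, z)`
and `(x, z ∘ σ)`. They have the same marginals, so a larger empirical mutual information means that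
`∏ Q(xᵢ, zᵢ) ≤ ∏ Q'(xᵢ, z_{σ i})`. This and the arithmetic-geometric mean inequality bound
`P(x) W(z | x)` by `(uᵀ M u)ⁿ` times the weight of `(x, z)` under the chain that alternates between
the two conditional distributions of `Q` and `Q'`, where `u` is the unit vector of the square roots
of the type of `z` (`prod_sq_le_rayleigh_mul_chainWeight`). The first factor is at most
`tr(M ^ ℓ) ^ c = T` by the spectral theorem. For fixed `Q` and `Q'` the chain weights add up to at
most `r ^ c`, being a product of traces of substochastic matrices, and there are at most
`(n + 1) ^ (2 r²)` pairs of types.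

*Upper bound for `T` by the overlap.* Multiplying `V` entrywise by characters of `ℤ/(n+1)` keeps the
transfer matrix of the form `V* V`, so every twisted version of `T` is nonnegative. Their average
over all `(n + 1) ^ r²` twists is, by orthogonality, the part of `T` that comes from those `(x, z)`
for which `(x, z)` and `(x, z ∘ σ)` have the same joint type, and the trivial twist is `T` itself.
Hence this part is at least `T / (n + 1) ^ r²`, and on it both likelihoods agree with their minimum
(`sum_prod_shift_le_sum_sameCounts`).

In total the factor is `n² (n + 1) ^ (3 r²) r ^ κ`, which for `r ≥ 2` is below the claimed one
because `1 + n ≤ (1 + n / κ) ^ κ` and `2 ≤ 1 + n / κ`. For `r = 1` all decoders have the same error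
probability.
-/

namespace DelayEstimation

/-! ### Closed walks and cycles of shifts -/

/-- Path expansion of the entries of a matrix power, tested against a function of both ends. -/
theorem sum_prod_path {α S : Type*} [Fintype α] [DecidableEq α] [CommSemiring S]
    (G : Matrix α α S) (m : ℕ) (F : α → α → S) :
    ∑ w : Fin (m + 1) → α, (∏ j : Fin m, G (w j.castSucc) (w j.succ)) * F (w 0) (w (Fin.last m)) =
      ∑ a, ∑ b, (G ^ m) a b * F a b := by
  induction m generalizing F with
  | zero =>
    rw [← (Equiv.funUnique (Fin 1) α).symm.sum_comp]
    simp [Matrix.one_apply]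
  | succ m ih =>
    rw [← (Fin.consEquiv fun _ : Fin (m + 2) => α).sum_comp, Fintype.sum_prod_type_right]
    have h : ∀ w : Fin (m + 1) → α, ∀ a : α,
        (∏ j : Fin (m + 1), G ((Fin.consEquiv fun _ : Fin (m + 2) => α) (a, w) j.castSucc)
          ((Fin.consEquiv fun _ : Fin (m + 2) => α) (a, w) j.succ)) *
          F ((Fin.consEquiv fun _ : Fin (m + 2) => α) (a, w) 0)
            ((Fin.consEquiv fun _ : Fin (m + 2) => α) (a, w) (Fin.last (m + 1))) =
        (∏ j : Fin m, G (w j.castSucc) (w j.succ)) *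
          (G a (w 0) * F a (w (Fin.last m))) := by
      intro w a
      rw [Fin.prod_univ_succ]
      simp only [Fin.consEquiv_apply, Fin.castSucc_zero, Fin.cons_zero, Fin.cons_succ,
        ← Fin.succ_last, Fin.castSucc_succ]
      ring
    simp only [h, ← Finset.mul_sum]
    rw [ih fun c b => ∑ a, G a c * F a b]
    simp only [pow_succ', Matrix.mul_apply, Finset.sum_mul, Finset.mul_sum]
    rw [Finset.sum_comm]
    conv_rhs => rw [Finset.sum_comm]
    refine Finset.sum_congr rfl fun b _ => ?_
    rw [Finset.sum_comm]
    exact Finset.sum_congr rfl fun a _ => Finset.sum_congr rfl fun c _ => by ring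

/-- The trace of a matrix power is the weighted count of closed walks. -/
theorem sum_prod_closedWalk {α S : Type*} [Fintype α] [DecidableEq α] [CommSemiring S]
    (G : Matrix α α S) (m : ℕ) :
    ∑ w : Fin (m + 1) → α, ∏ j, G (w j) (w (j + 1)) = (G ^ (m + 1)).trace := by
  have h := sum_prod_path G m fun a b => G b a
  simp only [Fin.prod_univ_castSucc, Fin.coeSucc_eq_succ, Fin.last_add_one, pow_succ,
    Matrix.trace, Matrix.diag_apply, Matrix.mul_apply]
  exact h

theorem shift_zpow_apply {n : ℕ} (s i : ZMod n) (k : ℤ) : (shift s ^ k) i = i + k • s := by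
  induction k with
  | zero => simp
  | succ k ih =>
    rw [zpow_add_one, ← (Commute.zpow_self (shift s) k).eq.symm, Equiv.Perm.mul_apply, ih]
    simp [shift, add_mul, add_assoc]
  | pred k ih =>
    rw [zpow_sub_one, ← ((Commute.zpow_self (shift s) _).inv_right).eq.symm,
      Equiv.Perm.mul_apply, ih]
    simp [shift]
    ring

/-- The cycles of the shift by `s` all have length `addOrderOf s`: the positions are pairs of a
cycle and a place on it, and the shift moves every place one step ahead. -/
theorem exists_cycle_coordinates {n : ℕ} [NeZero n] (s : ZMod n) (m : ℕ)
    (hm : addOrderOf s = m + 1) :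
    ∃ f : Quotient (Equiv.Perm.SameCycle.setoid (shift s)) × Fin (m + 1) ≃ ZMod n,
      ∀ q j, shift s (f (q, j)) = f (q, j + 1) := by
  let f : Quotient (Equiv.Perm.SameCycle.setoid (shift s)) × Fin (m + 1) → ZMod n :=
    fun p => p.1.out + (p.2 : ℕ) • s
  have hmk : ∀ p, Quotient.mk (Equiv.Perm.SameCycle.setoid (shift s)) (f p) = p.1 := by
    intro p
    conv_rhs => rw [← Quotient.out_eq p.1]
    refine Quotient.sound (Equiv.Perm.SameCycle.symm ⟨(p.2 : ℕ), ?_⟩)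
    rw [shift_zpow_apply]
    simp [f]
  have hinj : Function.Injective f := by
    intro p p' h
    have h1 : p.1 = p'.1 := by rw [← hmk p, ← hmk p', h]
    have h2 : (p.2 : ℕ) • s = (p'.2 : ℕ) • s := by
      have : p.1.out + (p.2 : ℕ) • s = p'.1.out + (p'.2 : ℕ) • s := h
      rw [h1] at this
      exact add_left_cancel this
    refine Prod.ext h1 (Fin.ext (nsmul_injOn_Iio_addOrderOf ?_ ?_ h2))
    · simpa [hm] using p.2.is_le
    · simpa [hm] using p'.2.is_le
  have hsurj : Function.Surjective f := by
    intro i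
    obtain ⟨k, hk⟩ : Equiv.Perm.SameCycle (shift s)
        (Quotient.mk (Equiv.Perm.SameCycle.setoid (shift s)) i).out i :=
      Quotient.exact (Quotient.out_eq (Quotient.mk (Equiv.Perm.SameCycle.setoid (shift s)) i))
    rw [shift_zpow_apply] at hk
    have hmem : k • s ∈ AddSubgroup.zmultiples s := ⟨k, rfl⟩
    rw [mem_zmultiples_iff_mem_range_addOrderOf, Finset.mem_image] at hmem
    obtain ⟨j, hj, hjs⟩ := hmem
    rw [Finset.mem_range, hm] at hj
    exact ⟨(_, ⟨j, hj⟩), (congrArg _ hjs).trans hk⟩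
  refine ⟨Equiv.ofBijective f ⟨hinj, hsurj⟩, fun q j => ?_⟩
  have h : ((j + 1 : Fin (m + 1)) : ℕ) • s = ((j : ℕ) + 1) • s := by
    rw [Fin.val_add, Fin.val_one', Nat.add_mod_mod, ← mod_addOrderOf_nsmul s (_ + 1), hm]
  change q.out + (j : ℕ) • s + s = q.out + ((j + 1 : Fin (m + 1)) : ℕ) • s
  rw [h, succ_nsmul, add_assoc]

theorem numCycles_mul_addOrderOf {n : ℕ} [NeZero n] (s : ZMod n) :
    numCycles (shift s) * addOrderOf s = n := by
  obtain ⟨m, hm⟩ := Nat.exists_eq_succ_of_ne_zero (addOrderOf_pos s).ne'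
  obtain ⟨f, -⟩ := exists_cycle_coordinates s m hm
  have h := Nat.card_congr f
  rw [Nat.card_prod, Nat.card_zmod, Nat.card_fin] at h
  rw [hm]
  exact h

/-- The transfer matrix formula: a product of weights along the cycles of a shift, summed over all
sequences, is a power of the trace of a matrix power. -/
theorem sum_prod_shift {n : ℕ} [NeZero n] {α S : Type*} [Fintype α] [DecidableEq α]
    [CommSemiring S] (s : ZMod n) (G : Matrix α α S) :
    ∑ z : ZMod n → α, ∏ i, G (z i) (z (shift s i)) =
      (G ^ addOrderOf s).trace ^ numCycles (shift s) := by
  classical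
  obtain ⟨m, hm⟩ := Nat.exists_eq_succ_of_ne_zero (addOrderOf_pos s).ne'
  obtain ⟨f, hf⟩ := exists_cycle_coordinates s m hm
  have : Fintype (Quotient (Equiv.Perm.SameCycle.setoid (shift s))) := Fintype.ofFinite _
  rw [hm, Nat.succ_eq_add_one, ← sum_prod_closedWalk, numCycles, Nat.card_eq_fintype_card,
    ← Finset.card_univ, ← Finset.prod_const, Finset.prod_univ_sum, Fintype.piFinset_univ,
    ← ((f.arrowCongr (Equiv.refl α)).symm.trans (Equiv.curry _ _ _)).symm.sum_comp]
  refine Finset.sum_congr rfl fun w _ => ?_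
  rw [← f.prod_comp, Fintype.prod_prod_type]
  simp [hf]

/-- The transfer matrix formula with an additional symbol attached to every step. -/
theorem sum_sum_prod_shift {n : ℕ} [NeZero n] {α β S : Type*} [Fintype α] [DecidableEq α]
    [Fintype β] [CommSemiring S] (s : ZMod n) (F : β → α → α → S) :
    ∑ x : ZMod n → β, ∑ z : ZMod n → α, ∏ i, F (x i) (z i) (z (shift s i)) =
      ((Matrix.of fun b b' => ∑ a, F a b b') ^ addOrderOf s).trace ^ numCycles (shift s) := by
  classical
  rw [← sum_prod_shift, Finset.sum_comm]
  refine Finset.sum_congr rfl fun z _ => ?_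
  simp only [Matrix.of_apply]
  rw [Finset.prod_univ_sum, Fintype.piFinset_univ]

/-! ### The maximum number of cycles -/

theorem numCycles_shift_sub_le_maxCycles {n : ℕ} {D : Finset (ZMod n)} {d e : ZMod n}
    (hd : d ∈ D) (he : e ∈ D) (hde : d ≠ e) :
    numCycles (shift (d - e)) ≤ maxCycles D := by
  have h := Finset.le_sup (f := fun p : ZMod n × ZMod n => numCycles ((shift p.1)⁻¹ * shift p.2))
    (Finset.mem_offDiag.2 ⟨he, hd, hde.symm⟩ : (e, d) ∈ D.offDiag)
  simpa only [maxCycles, shift_inv_mul_shift] using h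

theorem one_le_maxCycles {n : ℕ} [NeZero n] {D : Finset (ZMod n)} (hD : D.Nontrivial) :
    1 ≤ maxCycles D := by
  obtain ⟨d, hd, e, he, hne⟩ := hD
  refine le_trans ?_ (numCycles_shift_sub_le_maxCycles hd he hne)
  have h := numCycles_mul_addOrderOf (d - e)
  rw [Nat.one_le_iff_ne_zero]
  intro h0
  rw [h0, zero_mul] at h
  exact NeZero.ne n h.symm

theorem maxCycles_le {n : ℕ} [NeZero n] (D : Finset (ZMod n)) : maxCycles D ≤ n := by
  refine Finset.sup_le fun p _ => ?_
  rw [shift_inv_mul_shift]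
  exact Nat.le_of_dvd (NeZero.pos n) ⟨_, (numCycles_mul_addOrderOf _).symm⟩

/-! ### Traces of powers of matrices -/

/-- The trace of a power dominates the power of any Rayleigh quotient: expand in an eigenbasis and
apply Jensen's inequality. -/
theorem posSemidef_real_pow_le_trace {α : Type*} [Fintype α] [DecidableEq α] {M : Matrix α α ℝ}
    (hM : M.PosSemidef) {u : α → ℝ} (hu : u ⬝ᵥ u = 1) (l : ℕ) :
    (u ⬝ᵥ M.mulVec u) ^ l ≤ (M ^ l).trace := by
  have hH := hM.isHermitian
  set U : Matrix α α ℝ := (hH.eigenvectorUnitary : Matrix α α ℝ) with hU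
  set v : α → ℝ := hH.eigenvalues with hv
  have hUU : star U * U = 1 := Unitary.coe_star_mul_self _
  have hUU' : U * star U = 1 := Unitary.coe_mul_star_self _
  have hspec : M = U * Matrix.diagonal v * star U := by
    have := hH.spectral_theorem
    rw [Unitary.conjStarAlgAut_apply] at this
    simpa using this
  have htr : (M ^ l).trace = ∑ i, v i ^ l := by
    have : M ^ l = U * Matrix.diagonal (v ^ l) * star U := by
      rw [← Matrix.diagonal_pow]
      induction l with
      | zero => simp [hUU']
      | succ l ih =>
        rw [pow_succ, ih, pow_succ]
        conv_lhs => rw [hspec]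
        calc _ = U * Matrix.diagonal v ^ l * (star U * U) * Matrix.diagonal v * star U := by
              simp only [Matrix.mul_assoc]
          _ = _ := by rw [hUU]; simp only [Matrix.mul_assoc, Matrix.one_mul]
    rw [this, Matrix.trace_mul_comm, ← Matrix.mul_assoc, hUU, Matrix.one_mul,
      Matrix.trace_diagonal]
    simp
  set y : α → ℝ := (star U).mulVec u with hy
  have hyu : y = Matrix.vecMul u U := by
    rw [hy, ← Matrix.vecMul_transpose]
    rfl
  have hform : u ⬝ᵥ M.mulVec u = ∑ i, y i ^ 2 * v i := by
    conv_lhs => rw [hspec, ← Matrix.mulVec_mulVec, ← Matrix.mulVec_mulVec, Matrix.dotProduct_mulVec,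
      ← hyu, ← hy]
    simp only [dotProduct, Matrix.mulVec_diagonal]
    exact Finset.sum_congr rfl fun i _ => by ring
  have hnorm : ∑ i, y i ^ 2 = 1 := by
    have : y ⬝ᵥ y = 1 := by
      conv_lhs => lhs; rw [hyu]
      rw [hy, ← Matrix.dotProduct_mulVec, Matrix.mulVec_mulVec, hUU', Matrix.one_mulVec, hu]
    rw [← this]
    exact Finset.sum_congr rfl fun i _ => by ring
  have hv0 : ∀ i, 0 ≤ v i := hM.eigenvalues_nonneg
  rw [hform, htr]
  calc (∑ i, y i ^ 2 * v i) ^ l ≤ ∑ i, y i ^ 2 * v i ^ l :=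
        Real.pow_arith_mean_le_arith_mean_pow _ _ _ (fun i _ => sq_nonneg _) hnorm
          (fun i _ => hv0 i) l
    _ ≤ ∑ i, v i ^ l := Finset.sum_le_sum fun i _ => by
        refine mul_le_of_le_one_left (pow_nonneg (hv0 i) _) ?_
        rw [← hnorm]
        exact Finset.single_le_sum (f := fun i => y i ^ 2) (fun i _ => sq_nonneg _)
          (Finset.mem_univ i)

theorem trace_pow_le_card_of_row_sum_le_one {α : Type*} [Fintype α] [DecidableEq α]
    {q : Matrix α α ℝ} (h0 : ∀ a b, 0 ≤ q a b) (h1 : ∀ a, ∑ b, q a b ≤ 1) (l : ℕ) :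
    0 ≤ (q ^ l).trace ∧ (q ^ l).trace ≤ Fintype.card α := by
  have key : (∀ a b, 0 ≤ (q ^ l) a b) ∧ ∀ a, ∑ b, (q ^ l) a b ≤ 1 := by
    induction l with
    | zero =>
      refine ⟨fun a b => ?_, fun a => ?_⟩
      · rw [pow_zero, Matrix.one_apply]; split_ifs <;> norm_num
      · simp [Matrix.one_apply]
    | succ l ih =>
      simp only [pow_succ, Matrix.mul_apply]
      refine ⟨fun a b => Finset.sum_nonneg fun c _ => mul_nonneg (ih.1 a c) (h0 c b), fun a => ?_⟩
      rw [Finset.sum_comm]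
      simp only [← Finset.mul_sum]
      exact (Finset.sum_le_sum fun c _ =>
        mul_le_of_le_one_right (ih.1 a c) (h1 c)).trans (ih.2 a)
  refine ⟨Finset.sum_nonneg fun a _ => key.1 a a, ?_⟩
  calc (q ^ l).trace ≤ ∑ _a : α, (1 : ℝ) := Finset.sum_le_sum fun a _ =>
        (Finset.single_le_sum (f := fun b => (q ^ l) a b) (fun b _ => key.1 a b)
          (Finset.mem_univ a)).trans (key.2 a)
    _ = Fintype.card α := by simp

/-! ### Averaging over characters -/

/-- The pairs `(x, z)` and `(x, z')` of sequences have the same joint type, expressed by counts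
instead of frequencies. -/
def SameCounts {ι α β : Type*} [Fintype ι] [DecidableEq α] [DecidableEq β]
    (x : ι → β) (z z' : ι → α) : Prop :=
  ∀ a b, (Finset.univ.filter fun i => x i = a ∧ z i = b).card =
    (Finset.univ.filter fun i => x i = a ∧ z' i = b).card

theorem SameCounts.prod_eq {ι α β S : Type*} [Fintype ι] [Fintype α] [Fintype β] [DecidableEq α]
    [DecidableEq β] [CommMonoid S] {x : ι → β} {z z' : ι → α} (h : SameCounts x z z')
    (g : β → α → S) : ∏ i, g (x i) (z i) = ∏ i, g (x i) (z' i) := by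
  have key : ∀ w : ι → α, ∏ i, g (x i) (w i) =
      ∏ p : β × α, g p.1 p.2 ^ (Finset.univ.filter fun i => x i = p.1 ∧ w i = p.2).card := by
    intro w
    rw [← Finset.prod_fiberwise Finset.univ (fun i => (x i, w i)) fun i => g (x i) (w i)]
    refine Finset.prod_congr rfl fun p _ => ?_
    rw [← Finset.prod_const]
    refine Finset.prod_congr (by ext i; simp [Prod.ext_iff]) fun i hi => ?_
    obtain ⟨h1, h2⟩ := (Finset.mem_filter.1 hi).2
    rw [h1, h2]
  rw [key, key]
  exact Finset.prod_congr rfl fun p _ => by rw [h]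

open Classical in
/-- Averaging over all characters of `(ZMod N)^(β × α)` detects equality of joint types. -/
theorem sum_stdAddChar_counts {ι α β : Type*} [Fintype ι] [Fintype α] [Fintype β]
    [DecidableEq α] [DecidableEq β] (N : ℕ) [NeZero N] (hN : Fintype.card ι < N)
    (x : ι → β) (z z' : ι → α) :
    ∑ t : β × α → ZMod N,
      ∏ i, (ZMod.stdAddChar (t (x i, z i)) * ZMod.stdAddChar (-t (x i, z' i)) : ℂ) =
      if SameCounts x z z' then (Fintype.card (β × α → ZMod N) : ℂ) else 0 := by
  split_ifs with h
  · rw [← Finset.card_univ, ← nsmul_one, ← Finset.sum_const]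
    refine Finset.sum_congr rfl fun t _ => ?_
    rw [Finset.prod_mul_distrib, h.prod_eq fun a b => (ZMod.stdAddChar (t (a, b)) : ℂ),
      ← Finset.prod_mul_distrib]
    exact Finset.prod_eq_one fun i _ => by rw [← AddChar.map_add_eq_mul]; simp
  · let L : (β × α → ZMod N) →+ ZMod N :=
      ∑ i, (Pi.evalAddMonoidHom (fun _ => ZMod N) (x i, z i) -
        Pi.evalAddMonoidHom (fun _ => ZMod N) (x i, z' i))
    have hL : ∀ t, L t = ∑ i, (t (x i, z i) - t (x i, z' i)) := by
      intro t; simp [L]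
    have hψ : ∀ t, ∏ i, (ZMod.stdAddChar (t (x i, z i)) * ZMod.stdAddChar (-t (x i, z' i)) : ℂ) =
        (ZMod.stdAddChar.compAddMonoidHom L : AddChar (β × α → ZMod N) ℂ) t := by
      intro t
      rw [AddChar.compAddMonoidHom_apply, hL,
        show (ZMod.stdAddChar (∑ i, (t (x i, z i) - t (x i, z' i))) : ℂ) =
          ∏ i, ZMod.stdAddChar (t (x i, z i) - t (x i, z' i)) from
        map_prod (ZMod.stdAddChar (N := N)).toMonoidHom
          (fun i => Multiplicative.ofAdd (t (x i, z i) - t (x i, z' i))) Finset.univ]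
      exact Finset.prod_congr rfl fun i _ => by rw [sub_eq_add_neg, AddChar.map_add_eq_mul]
    simp only [hψ]
    rw [AddChar.sum_eq_zero_iff_ne_zero]
    intro h0
    refine h fun a b => ?_
    -- Testing with the indicator of `(a, b)` shows that the two counts agree modulo `N`.
    have h1 := DFunLike.congr_fun h0 (Pi.single (a, b) 1)
    rw [AddChar.compAddMonoidHom_apply, AddChar.zero_apply] at h1
    have h2 := ZMod.injective_stdAddChar (h1.trans (AddChar.map_zero_eq_one _).symm)
    rw [hL, Finset.sum_sub_distrib, sub_eq_zero] at h2
    simp only [Pi.single_apply, Prod.mk.injEq, Finset.sum_boole] at h2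
    rw [ZMod.natCast_eq_natCast_iff', Nat.mod_eq_of_lt, Nat.mod_eq_of_lt] at h2
    · exact h2
    · exact (Finset.card_le_univ _).trans_lt hN
    · exact (Finset.card_le_univ _).trans_lt hN

open scoped ComplexOrder Classical in
/-- Up to the number of twists by characters, the sum over all pairs of sequences is carried by the
pairs whose joint type does not change under the shift. -/
theorem sum_prod_shift_le_sum_sameCounts {n : ℕ} [NeZero n] {α β : Type*} [Fintype α] [Fintype β]
    [DecidableEq α] [DecidableEq β] (s : ZMod n) (V : β → α → ℝ) :
    ∑ x : ZMod n → β, ∑ z : ZMod n → α, ∏ i, (V (x i) (z i) * V (x i) (z (shift s i))) ≤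
      ((n : ℝ) + 1) ^ (Fintype.card β * Fintype.card α) *
        ∑ x : ZMod n → β, ∑ z : ZMod n → α, if SameCounts x z (fun i => z (shift s i)) then
          ∏ i, (V (x i) (z i) * V (x i) (z (shift s i))) else 0 := by
  let f : (β × α → ZMod (n + 1)) → ℂ := fun t =>
    ∑ x : ZMod n → β, ∑ z : ZMod n → α,
      ∏ i, ((V (x i) (z i) * ZMod.stdAddChar (t (x i, z i))) *
        (V (x i) (z (shift s i)) * ZMod.stdAddChar (-t (x i, z (shift s i)))))
  have hpos : ∀ t, 0 ≤ f t := by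
    intro t
    -- The twisted sum is a power of the trace of a power of `Bᴴ * B`.
    let B : Matrix β α ℂ := Matrix.of fun a b => V a b * ZMod.stdAddChar (-t (a, b))
    have hB : (Matrix.of fun b b' => ∑ a, (V a b * ZMod.stdAddChar (t (a, b))) *
        (V a b' * ZMod.stdAddChar (-t (a, b'))) : Matrix α α ℂ) = B.conjTranspose * B := by
      ext b b'
      simp [B, Matrix.mul_apply, AddChar.map_neg_eq_conj]
    have := sum_sum_prod_shift s fun a b b' => ((V a b * ZMod.stdAddChar (t (a, b))) *
        (V a b' * ZMod.stdAddChar (-t (a, b'))) : ℂ)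
    rw [show f t = _ from this, hB]
    exact pow_nonneg ((Matrix.posSemidef_conjTranspose_mul_self B).pow _).trace_nonneg _
  have hf0 : f 0 = ((∑ x : ZMod n → β, ∑ z : ZMod n → α,
      ∏ i, (V (x i) (z i) * V (x i) (z (shift s i))) : ℝ) : ℂ) := by
    simp [f]
  have hsum : ∑ t, f t = (((n : ℝ) + 1) ^ (Fintype.card β * Fintype.card α) *
        ∑ x : ZMod n → β, ∑ z : ZMod n → α, if SameCounts x z (fun i => z (shift s i)) then
          ∏ i, (V (x i) (z i) * V (x i) (z (shift s i))) else 0 : ℝ) := by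
    simp only [f]
    rw [Finset.sum_comm]
    push_cast
    rw [Finset.mul_sum]
    refine Finset.sum_congr rfl fun x _ => ?_
    rw [Finset.sum_comm, Finset.mul_sum]
    refine Finset.sum_congr rfl fun z _ => ?_
    have h := sum_stdAddChar_counts (n + 1) (by simp [ZMod.card]) x z fun i => z (shift s i)
    have h' : ∀ t : β × α → ZMod (n + 1),
        ∏ i, ((V (x i) (z i) * ZMod.stdAddChar (t (x i, z i))) *
        (V (x i) (z (shift s i)) * ZMod.stdAddChar (-t (x i, z (shift s i)))) : ℂ) =
        (∏ i, (V (x i) (z i) * V (x i) (z (shift s i)) : ℂ)) *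
        ∏ i, (ZMod.stdAddChar (t (x i, z i)) * ZMod.stdAddChar (-t (x i, z (shift s i))) : ℂ) := by
      intro t
      rw [← Finset.prod_mul_distrib]
      exact Finset.prod_congr rfl fun i _ => by ring
    simp only [h', ← Finset.mul_sum]
    rw [h]
    split_ifs
    · simp [ZMod.card, mul_comm]
    · simp
  have hle : f 0 ≤ ∑ t, f t :=
    Finset.single_le_sum (fun t _ => hpos t) (Finset.mem_univ 0)
  rw [hf0, hsum] at hle
  exact_mod_cast hle

/-! ### Types and empirical mutual information -/

/-- The functions that can be joint types of sequences of length `n`. -/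
noncomputable def jointTypes (n r : ℕ) : Finset (Fin r → Fin r → ℝ) :=
  Finset.univ.image fun (k : Fin r → Fin r → Fin (n + 1)) a b => ((k a b : ℕ) : ℝ) / n

theorem nonneg_of_mem_jointTypes {n r : ℕ} {Q : Fin r → Fin r → ℝ} (hQ : Q ∈ jointTypes n r)
    (a b : Fin r) : 0 ≤ Q a b := by
  obtain ⟨k, -, rfl⟩ := Finset.mem_image.1 hQ
  positivity

theorem card_jointTypes_le (n r : ℕ) : ((jointTypes n r).card : ℝ) ≤ ((n : ℝ) + 1) ^ (r * r) := by
  have h : (jointTypes n r).card ≤ (n + 1) ^ (r * r) := by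
    refine Finset.card_image_le.trans_eq ?_
    simp [pow_mul]
  exact_mod_cast h

section Types

variable {n r : ℕ} [NeZero n]

theorem sum_jointType_mul (x y : Sequence n r) (g : Fin r → Fin r → ℝ) :
    (n : ℝ) * ∑ a, ∑ b, jointType x y a b * g a b = ∑ i, g (x i) (y i) := by
  have hn : (n : ℝ) ≠ 0 := NeZero.ne _
  rw [← Finset.sum_fiberwise Finset.univ (fun i => (x i, y i)) fun i => g (x i) (y i),
    Fintype.sum_prod_type, Finset.mul_sum]
  refine Finset.sum_congr rfl fun a _ => ?_
  rw [Finset.mul_sum]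
  refine Finset.sum_congr rfl fun b _ => ?_
  rw [jointType, ← mul_assoc, mul_div_cancel₀ _ hn, ← nsmul_eq_mul, ← Finset.sum_const]
  refine Finset.sum_congr (by ext i; simp) fun i hi => ?_
  have hi := (Finset.mem_filter.1 hi).2
  rw [(Prod.mk.inj hi).1, (Prod.mk.inj hi).2]

theorem jointType_nonneg (x y : Sequence n r) (a b : Fin r) : 0 ≤ jointType x y a b := by
  unfold jointType; positivity

theorem jointType_pos (x y : Sequence n r) (i : ZMod n) : 0 < jointType x y (x i) (y i) := by
  have hn : 0 < (n : ℝ) := Nat.cast_pos.2 (NeZero.pos n)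
  refine div_pos (Nat.cast_pos.2 (Finset.card_pos.2 ⟨i, by simp⟩)) hn

theorem seqType_nonneg (x : Sequence n r) (a : Fin r) : 0 ≤ seqType x a := by
  unfold seqType; positivity

theorem seqType_pos (x : Sequence n r) (i : ZMod n) : 0 < seqType x (x i) := by
  have hn : 0 < (n : ℝ) := Nat.cast_pos.2 (NeZero.pos n)
  refine div_pos (Nat.cast_pos.2 (Finset.card_pos.2 ⟨i, by simp⟩)) hn

theorem sum_jointType_right (x y : Sequence n r) (a : Fin r) :
    ∑ b, jointType x y a b = seqType x a := by
  simp only [jointType, seqType, ← Finset.sum_div]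
  congr 1
  rw [Finset.card_eq_sum_card_fiberwise (f := y) (t := Finset.univ) fun _ _ =>
    Finset.mem_coe.2 (Finset.mem_univ _)]
  simp [Finset.filter_filter]

theorem sum_jointType_left (x y : Sequence n r) (b : Fin r) :
    ∑ a, jointType x y a b = seqType y b := by
  simp only [jointType, seqType, ← Finset.sum_div]
  congr 1
  rw [Finset.card_eq_sum_card_fiberwise (f := x) (t := Finset.univ) fun _ _ =>
    Finset.mem_coe.2 (Finset.mem_univ _)]
  simp [Finset.filter_filter, and_comm]

theorem sum_seqType (x : Sequence n r) : ∑ a, seqType x a = 1 := by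
  have h := sum_jointType_mul x x fun _ _ => 1
  have hn : (n : ℝ) ≠ 0 := NeZero.ne _
  simp only [mul_one, sum_jointType_right] at h
  simpa [ZMod.card, hn] using h

theorem seqType_comp_perm (z : Sequence n r) (σ : Equiv.Perm (ZMod n)) :
    seqType (fun i => z (σ i)) = seqType z := by
  ext a
  simp only [seqType]
  congr 2
  exact Finset.card_equiv σ fun i => by simp

/-- The empirical mutual information is a normalized log-likelihood ratio. -/
theorem mul_empiricalMI_eq_logb_prod (x y : Sequence n r) :
    (n : ℝ) * empiricalMI x y =
      Real.logb 2 (∏ i, jointType x y (x i) (y i) / (seqType x (x i) * seqType y (y i))) := by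
  rw [empiricalMI, sum_jointType_mul x y fun a b =>
    Real.logb 2 (jointType x y a b / (seqType x a * seqType y b)), Real.logb_prod]
  exact fun i _ => (div_pos (jointType_pos x y i)
    (mul_pos (seqType_pos x i) (seqType_pos y i))).ne'

/-- Realignment does not change the type of the received sequence, so a larger empirical mutual
information means a larger likelihood under the own joint type. -/
theorem prod_jointType_le_of_empiricalMI_le (x z : Sequence n r) (σ : Equiv.Perm (ZMod n))
    (h : empiricalMI x z ≤ empiricalMI x fun i => z (σ i)) :
    ∏ i, jointType x z (x i) (z i) ≤
      ∏ i, jointType x (fun i => z (σ i)) (x i) (z (σ i)) := by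
  have hn : 0 < (n : ℝ) := Nat.cast_pos.2 (NeZero.pos n)
  have h' := mul_le_mul_of_nonneg_left h hn.le
  rw [mul_empiricalMI_eq_logb_prod, mul_empiricalMI_eq_logb_prod,
    Real.logb_le_logb (by norm_num) (Finset.prod_pos fun i _ => div_pos (jointType_pos x z i)
      (mul_pos (seqType_pos x i) (seqType_pos z i)))
      (Finset.prod_pos fun i _ => div_pos (jointType_pos x _ i)
      (mul_pos (seqType_pos x i) (seqType_pos _ i)))] at h'
  simp only [Finset.prod_div_distrib, Finset.prod_mul_distrib, seqType_comp_perm] at h'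
  rw [Equiv.prod_comp σ fun i => seqType z (z i)] at h'
  have hX : 0 < ∏ i, seqType x (x i) := Finset.prod_pos fun i _ => seqType_pos x i
  have hZ : 0 < ∏ i, seqType z (z i) := Finset.prod_pos fun i _ => seqType_pos z i
  exact (div_le_div_iff_of_pos_right (mul_pos hX hZ)).1 h'

/-- A Gibbs variational bound: the joint type `Q` of `(x, z)`, with marginals `T₁`, `T₂`, gives the
lower bound `exp (∑ Q log (V² T₁ T₂ / Q²))` for the Rayleigh quotient of `Vᵀ V` at `√T₂`. -/
theorem prod_sq_mul_le_rayleigh (x z : Sequence n r) {V : Fin r → Fin r → ℝ}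
    (hV : ∀ a b, 0 ≤ V a b) :
    ∏ i, (V (x i) (z i) ^ 2 *
        (seqType x (x i) * seqType z (z i) / jointType x z (x i) (z i) ^ 2)) ≤
      ((fun b => √(seqType z b)) ⬝ᵥ ((Matrix.of V).transpose * Matrix.of V).mulVec
        (fun b => √(seqType z b))) ^ n := by
  have hn : 0 < (n : ℝ) := Nat.cast_pos.2 (NeZero.pos n)
  set Q := jointType x z
  set T := seqType x
  set S := seqType z
  -- The factors on the left are the squares of `g`.
  let g : Fin r → Fin r → ℝ := fun a b => V a b * √(T a) * √(S b) / Q a b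
  have hg : ∀ a b, 0 ≤ g a b := fun a b => by
    have := jointType_nonneg x z a b
    have := hV a b
    positivity
  have hsq : ∏ i, (V (x i) (z i) ^ 2 * (T (x i) * S (z i) / Q (x i) (z i) ^ 2)) =
      (∏ i, g (x i) (z i)) ^ 2 := by
    rw [← Finset.prod_pow]
    refine Finset.prod_congr rfl fun i _ => ?_
    simp only [g, div_pow, mul_pow]
    rw [Real.sq_sqrt (seqType_nonneg _ _), Real.sq_sqrt (seqType_nonneg _ _)]
    ring
  have hamgm : ∏ i, g (x i) (z i) ≤ (∑ a, ∑ b, Q a b * g a b) ^ n := by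
    have h := Real.geom_mean_le_arith_mean_weighted Finset.univ (fun _ : ZMod n => (n : ℝ)⁻¹)
      (fun i => g (x i) (z i)) (fun _ _ => by positivity) (by simp [ZMod.card, hn.ne'])
      fun i _ => hg _ _
    rw [← Finset.mul_sum, ← sum_jointType_mul, inv_mul_cancel_left₀ hn.ne'] at h
    refine le_trans (le_of_eq ?_) (pow_le_pow_left₀ (Finset.prod_nonneg fun i _ =>
      Real.rpow_nonneg (hg _ _) _) h n)
    rw [← Finset.prod_pow]
    exact Finset.prod_congr rfl fun i _ => (Real.rpow_inv_natCast_pow (hg _ _) (NeZero.ne n)).symm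
  have hmean : ∑ a, ∑ b, Q a b * g a b ≤ ∑ a, √(T a) * ∑ b, V a b * √(S b) := by
    refine Finset.sum_le_sum fun a _ => ?_
    rw [Finset.mul_sum]
    refine Finset.sum_le_sum fun b _ => ?_
    have : 0 ≤ √(T a) * (V a b * √(S b)) := by
      have := hV a b
      positivity
    by_cases hQ : Q a b = 0
    · simpa [hQ] using this
    · exact le_of_eq (by simp only [g]; field_simp)
  have hcs : (∑ a, √(T a) * ∑ b, V a b * √(S b)) ^ 2 ≤
      (fun b => √(S b)) ⬝ᵥ ((Matrix.of V).transpose * Matrix.of V).mulVec (fun b => √(S b)) := by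
    have h := Finset.sum_mul_sq_le_sq_mul_sq Finset.univ (fun a => √(T a))
      fun a => ∑ b, V a b * √(S b)
    have h1 : ∑ a, √(T a) ^ 2 = 1 := by
      rw [← sum_seqType x]
      exact Finset.sum_congr rfl fun a _ => Real.sq_sqrt (seqType_nonneg _ _)
    rw [h1, one_mul] at h
    refine h.trans (le_of_eq ?_)
    rw [← Matrix.mulVec_mulVec, Matrix.dotProduct_mulVec, Matrix.vecMul_transpose]
    exact Finset.sum_congr rfl fun a _ => sq _
  rw [hsq]
  calc (∏ i, g (x i) (z i)) ^ 2 ≤ ((∑ a, √(T a) * ∑ b, V a b * √(S b)) ^ n) ^ 2 := by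
        refine pow_le_pow_left₀ (Finset.prod_nonneg fun i _ => hg _ _) (hamgm.trans ?_) 2
        refine pow_le_pow_left₀ (Finset.sum_nonneg fun a _ => Finset.sum_nonneg fun b _ =>
          mul_nonneg (jointType_nonneg _ _ _ _) (hg a b)) hmean n
    _ = ((∑ a, √(T a) * ∑ b, V a b * √(S b)) ^ 2) ^ n := by rw [← pow_mul, ← pow_mul, mul_comm]
    _ ≤ _ := pow_le_pow_left₀ (sq_nonneg _) hcs n

/-! ### Chain weights -/

/-- The likelihood of `(x, z)` under the chain in which each output is followed by an input drawn
from the reverse channel of `Q` and then by an output drawn from the channel of `Q'`. A symbol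
without mass has the zero row as its conditional distribution, so the channels are substochastic in
general. -/
noncomputable def chainWeight (Q Q' : Fin r → Fin r → ℝ) (σ : Equiv.Perm (ZMod n))
    (x z : Sequence n r) : ℝ :=
  ∏ i, (Q (x i) (z i) / ∑ a, Q a (z i)) * (Q' (x i) (z (σ i)) / ∑ b, Q' (x i) b)

theorem chainWeight_nonneg {Q Q' : Fin r → Fin r → ℝ} (hQ : ∀ a b, 0 ≤ Q a b)
    (hQ' : ∀ a b, 0 ≤ Q' a b) (σ : Equiv.Perm (ZMod n)) (x z : Sequence n r) :
    0 ≤ chainWeight Q Q' σ x z :=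
  Finset.prod_nonneg fun _ _ => mul_nonneg
    (div_nonneg (hQ _ _) (Finset.sum_nonneg fun _ _ => hQ _ _))
    (div_nonneg (hQ' _ _) (Finset.sum_nonneg fun _ _ => hQ' _ _))

/-- The likelihood of a confusable pair is bounded by a Rayleigh quotient and a chain weight. The
hypothesis allows one factor `Q` of `Q²` to be replaced by `Q'`. -/
theorem prod_sq_le_rayleigh_mul_chainWeight (x z : Sequence n r) (σ : Equiv.Perm (ZMod n))
    {V : Fin r → Fin r → ℝ} (hV : ∀ a b, 0 ≤ V a b)
    (h : empiricalMI x z ≤ empiricalMI x fun i => z (σ i)) :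
    ∏ i, V (x i) (z i) ^ 2 ≤
      ((fun b => √(seqType z b)) ⬝ᵥ ((Matrix.of V).transpose * Matrix.of V).mulVec
        (fun b => √(seqType z b))) ^ n *
      chainWeight (jointType x z) (jointType x fun i => z (σ i)) σ x z := by
  have h1 := prod_sq_mul_le_rayleigh x z hV
  have h2 := prod_jointType_le_of_empiricalMI_le x z σ h
  have hX : 0 < ∏ i, seqType x (x i) := Finset.prod_pos fun i _ => seqType_pos x i
  have hZ : 0 < ∏ i, seqType z (z i) := Finset.prod_pos fun i _ => seqType_pos z i
  have hQ : 0 < ∏ i, jointType x z (x i) (z i) := Finset.prod_pos fun i _ => jointType_pos x z i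
  have hV2 : 0 ≤ ∏ i, V (x i) (z i) ^ 2 := Finset.prod_nonneg fun i _ => sq_nonneg _
  have hw : chainWeight (jointType x z) (jointType x fun i => z (σ i)) σ x z =
      (∏ i, jointType x z (x i) (z i)) / (∏ i, seqType z (z i)) *
      ((∏ i, jointType x (fun i => z (σ i)) (x i) (z (σ i))) / ∏ i, seqType x (x i)) := by
    simp only [chainWeight, sum_jointType_left, sum_jointType_right, Finset.prod_mul_distrib,
      Finset.prod_div_distrib]
  rw [hw]
  rw [Finset.prod_mul_distrib, Finset.prod_div_distrib, Finset.prod_mul_distrib,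
    Finset.prod_pow _ 2 fun i => jointType x z (x i) (z i)] at h1
  set A := ∏ i, jointType x z (x i) (z i)
  set A' := ∏ i, jointType x (fun i => z (σ i)) (x i) (z (σ i))
  set X := ∏ i, seqType x (x i)
  set Z := ∏ i, seqType z (z i)
  set U := ∏ i, V (x i) (z i) ^ 2
  calc U = U * (X * Z / A ^ 2) * (A / Z * (A / X)) := by field_simp
    _ ≤ U * (X * Z / A ^ 2) * (A / Z * (A' / X)) := by gcongr
    _ ≤ _ := mul_le_mul_of_nonneg_right h1
        (mul_pos (div_pos hQ hZ) (div_pos (hQ.trans_le h2) hX)).le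

/-- The chain weights for fixed `Q` and `Q'` come from a substochastic transfer matrix. -/
theorem sum_chainWeight_le {Q Q' : Fin r → Fin r → ℝ} (hQ : ∀ a b, 0 ≤ Q a b)
    (hQ' : ∀ a b, 0 ≤ Q' a b) (s : ZMod n) :
    ∑ x, ∑ z, chainWeight Q Q' (shift s) x z ≤ (r : ℝ) ^ numCycles (shift s) := by
  have h := sum_sum_prod_shift s fun a b b' : Fin r =>
    (Q a b / ∑ a, Q a b) * (Q' a b' / ∑ b, Q' a b)
  rw [show ∑ x, ∑ z, chainWeight Q Q' (shift s) x z = _ from h]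
  have h0 : ∀ a b, 0 ≤ Q a b / ∑ a, Q a b := fun a b =>
    div_nonneg (hQ _ _) (Finset.sum_nonneg fun a _ => hQ _ _)
  have h0' : ∀ a b, 0 ≤ Q' a b / ∑ b, Q' a b := fun a b =>
    div_nonneg (hQ' _ _) (Finset.sum_nonneg fun a _ => hQ' _ _)
  have htr := trace_pow_le_card_of_row_sum_le_one (q := Matrix.of fun b b' =>
    ∑ a, (Q a b / ∑ a, Q a b) * (Q' a b' / ∑ b, Q' a b))
    (fun b b' => Finset.sum_nonneg (s := Finset.univ) fun a _ => mul_nonneg (h0 a b) (h0' a b'))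
    (fun b => by
      simp only [Matrix.of_apply]
      rw [Finset.sum_comm]
      simp only [← Finset.mul_sum, ← Finset.sum_div]
      calc _ ≤ ∑ a, Q a b / ∑ a, Q a b :=
            Finset.sum_le_sum fun a _ => mul_le_of_le_one_right (h0 _ _) (div_self_le_one _)
        _ ≤ 1 := by rw [← Finset.sum_div]; exact div_self_le_one _) (addOrderOf s)
  rw [Fintype.card_fin] at htr
  exact pow_le_pow_left₀ htr.1 htr.2 _

theorem jointType_mem_jointTypes (x y : Sequence n r) : jointType x y ∈ jointTypes n r := by
  refine Finset.mem_image.2 ⟨fun a b => ⟨_, Nat.lt_succ_of_le ((Finset.card_le_univ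
    (Finset.univ.filter fun i => x i = a ∧ y i = b)).trans_eq (ZMod.card n))⟩,
    Finset.mem_univ _, rfl⟩

/-- The chain weight of every pair of sequences is taken at its own joint types; summing over all
possible pairs of types instead costs only their number. -/
theorem sum_chainWeight_jointType_le (s : ZMod n) :
    ∑ x : Sequence n r, ∑ z : Sequence n r, chainWeight (jointType x z)
      (jointType x fun i => z (shift s i)) (shift s) x z ≤
      ((n : ℝ) + 1) ^ (2 * (r * r)) * (r : ℝ) ^ numCycles (shift s) := by
  calc _ ≤ ∑ x : Sequence n r, ∑ z : Sequence n r, ∑ p ∈ jointTypes n r ×ˢ jointTypes n r,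
        chainWeight p.1 p.2 (shift s) x z := by
        refine Finset.sum_le_sum fun x _ => Finset.sum_le_sum fun z _ => ?_
        refine Finset.single_le_sum (f := fun p : (Fin r → Fin r → ℝ) × (Fin r → Fin r → ℝ) =>
          chainWeight p.1 p.2 (shift s) x z)
          (a := (jointType x z, jointType x fun i => z (shift s i))) (fun p hp => ?_)
          (Finset.mk_mem_product (jointType_mem_jointTypes _ _) (jointType_mem_jointTypes _ _))
        rw [Finset.mem_product] at hp
        exact chainWeight_nonneg (nonneg_of_mem_jointTypes hp.1)
          (nonneg_of_mem_jointTypes hp.2) _ _ _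
    _ = ∑ p ∈ jointTypes n r ×ˢ jointTypes n r, ∑ x, ∑ z, chainWeight p.1 p.2 (shift s) x z := by
        rw [Finset.sum_comm (s := jointTypes n r ×ˢ jointTypes n r)]
        exact Finset.sum_congr rfl fun x _ => Finset.sum_comm
    _ ≤ ∑ p ∈ jointTypes n r ×ˢ jointTypes n r, (r : ℝ) ^ numCycles (shift s) := by
        refine Finset.sum_le_sum fun p hp => ?_
        rw [Finset.mem_product] at hp
        exact sum_chainWeight_le (nonneg_of_mem_jointTypes hp.1)
          (nonneg_of_mem_jointTypes hp.2) s
    _ = ((jointTypes n r).card : ℝ) ^ 2 * (r : ℝ) ^ numCycles (shift s) := by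
        rw [Finset.sum_const, Finset.card_product, nsmul_eq_mul, sq, Nat.cast_mul]
    _ ≤ _ := by
        rw [mul_comm 2, pow_mul]
        gcongr
        exact card_jointTypes_le n r

end Types

/-! ### Confusion of two delays -/

theorem prod_sqrt_sq {n r : ℕ} [NeZero n] {P : Fin r → ℝ} {W : Fin r → Fin r → ℝ}
    (hP : ∀ a, 0 ≤ P a) (hW : ∀ a b, 0 ≤ W a b) (x z : Sequence n r) :
    ∏ i, √(P (x i) * W (x i) (z i)) ^ 2 = sourceProb P x * channelProb W x z := by
  rw [sourceProb, channelProb, ← Finset.prod_mul_distrib]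
  exact Finset.prod_congr rfl fun i _ => Real.sq_sqrt (mul_nonneg (hP _) (hW _ _))

theorem sourceProb_nonneg {n r : ℕ} [NeZero n] {P : Fin r → ℝ} (hP : ∀ a, 0 ≤ P a)
    (x : Sequence n r) : 0 ≤ sourceProb P x := Finset.prod_nonneg fun _ _ => hP _

theorem channelProb_nonneg {n r : ℕ} [NeZero n] {W : Fin r → Fin r → ℝ}
    (hW : ∀ a b, 0 ≤ W a b) (x z : Sequence n r) : 0 ≤ channelProb W x z :=
  Finset.prod_nonneg fun _ _ => hW _ _

/-- The Rayleigh quotient at the type of any one sequence bounds the total weight from below. -/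
theorem rayleigh_pow_le_sum {n r : ℕ} [NeZero n] (s : ZMod n) (V : Fin r → Fin r → ℝ)
    (z : Sequence n r) :
    ((fun b => √(seqType z b)) ⬝ᵥ ((Matrix.of V).transpose * Matrix.of V).mulVec
        (fun b => √(seqType z b))) ^ n ≤
      ∑ x : Sequence n r, ∑ z : Sequence n r,
        ∏ i, (V (x i) (z i) * V (x i) (z (shift s i))) := by
  have hM : ((Matrix.of V).transpose * Matrix.of V).PosSemidef := by
    have := Matrix.posSemidef_conjTranspose_mul_self (Matrix.of V)
    rwa [Matrix.conjTranspose_eq_transpose_of_trivial] at this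
  have hu : (fun b => √(seqType z b)) ⬝ᵥ (fun b => √(seqType z b)) = 1 := by
    rw [← sum_seqType z]
    exact Finset.sum_congr rfl fun b _ => Real.mul_self_sqrt (seqType_nonneg _ _)
  have h := sum_sum_prod_shift s fun a b b' => V a b * V a b'
  have hMe : (Matrix.of fun b b' => ∑ a, V a b * V a b') =
      (Matrix.of V).transpose * Matrix.of V := by
    ext b b'
    simp [Matrix.mul_apply]
  rw [h, hMe]
  set R := (fun b => √(seqType z b)) ⬝ᵥ ((Matrix.of V).transpose * Matrix.of V).mulVec
    (fun b => √(seqType z b)) with hR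
  have hRn : R ^ n = (R ^ addOrderOf s) ^ numCycles (shift s) := by
    rw [← pow_mul, mul_comm, numCycles_mul_addOrderOf]
  rw [hRn]
  refine pow_le_pow_left₀ (pow_nonneg ?_ _) (posSemidef_real_pow_le_trace hM hu _) _
  simpa [hR] using hM.dotProduct_mulVec_nonneg fun b => √(seqType z b)

/-- The comparison for one pair of delays whose difference is `s`: the probability that the wrong
delay has at least the empirical mutual information of the right one is, up to a factor, at most
the total overlap of the two likelihoods. -/
theorem sum_confusion_le {n r : ℕ} [NeZero n] {P : Fin r → ℝ} {W : Fin r → Fin r → ℝ}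
    (hP : ∀ a, 0 ≤ P a) (hW : ∀ a b, 0 ≤ W a b) (s : ZMod n) :
    (∑ x : Sequence n r, ∑ z : Sequence n r,
      if empiricalMI x z ≤ empiricalMI x (transform (shift s) z) then
        sourceProb P x * channelProb W x z else 0) ≤
      ((n : ℝ) + 1) ^ (3 * (r * r)) * (r : ℝ) ^ numCycles (shift s) *
        ∑ x : Sequence n r, ∑ z : Sequence n r,
          sourceProb P x * min (channelProb W x z) (channelProb W x (transform (shift s) z)) := by
  classical
  let V : Fin r → Fin r → ℝ := fun a b => √(P a * W a b)
  have hV : ∀ a b, 0 ≤ V a b := fun a b => Real.sqrt_nonneg _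
  set T := ∑ x : Sequence n r, ∑ z : Sequence n r,
        ∏ i, (V (x i) (z i) * V (x i) (z (shift s i))) with hT
  have hT0 : 0 ≤ T := Finset.sum_nonneg fun x _ => Finset.sum_nonneg fun z _ =>
    Finset.prod_nonneg fun i _ => mul_nonneg (hV _ _) (hV _ _)
  have hw0 : ∀ x z : Sequence n r, 0 ≤ chainWeight (jointType x z)
      (jointType x fun i => z (shift s i)) (shift s) x z := fun x z =>
    chainWeight_nonneg (jointType_nonneg _ _) (jointType_nonneg _ _) _ _ _
  have h1 : (∑ x : Sequence n r, ∑ z : Sequence n r,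
      if empiricalMI x z ≤ empiricalMI x (transform (shift s) z) then
        sourceProb P x * channelProb W x z else 0) ≤
      T * (((n : ℝ) + 1) ^ (2 * (r * r)) * (r : ℝ) ^ numCycles (shift s)) := by
    refine le_trans ?_ (mul_le_mul_of_nonneg_left (sum_chainWeight_jointType_le s) hT0)
    rw [Finset.mul_sum]
    refine Finset.sum_le_sum fun x _ => ?_
    rw [Finset.mul_sum]
    refine Finset.sum_le_sum fun z _ => ?_
    split_ifs with h
    · rw [← prod_sqrt_sq hP hW]
      exact (prod_sq_le_rayleigh_mul_chainWeight x z (shift s) hV h).trans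
        (mul_le_mul_of_nonneg_right (rayleigh_pow_le_sum s V z) (hw0 x z))
    · exact mul_nonneg hT0 (hw0 x z)
  have h2 : T ≤ ((n : ℝ) + 1) ^ (r * r) * ∑ x : Sequence n r, ∑ z : Sequence n r,
          sourceProb P x * min (channelProb W x z) (channelProb W x (transform (shift s) z)) := by
    have h := sum_prod_shift_le_sum_sameCounts s V
    rw [Fintype.card_fin] at h
    refine h.trans (mul_le_mul_of_nonneg_left (Finset.sum_le_sum fun x _ =>
      Finset.sum_le_sum fun z _ => ?_) (by positivity))
    split_ifs with hs
    · rw [Finset.prod_mul_distrib, ← hs.prod_eq V, ← Finset.prod_mul_distrib,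
        show channelProb W x (transform (shift s) z) = channelProb W x z from (hs.prod_eq W).symm,
        min_self, ← prod_sqrt_sq hP hW]
      exact (Finset.prod_congr rfl fun i _ => (sq _).symm).le
    · exact mul_nonneg (sourceProb_nonneg hP x)
        (le_min (channelProb_nonneg hW _ _) (channelProb_nonneg hW _ _))
  refine h1.trans ((mul_le_mul_of_nonneg_right h2 (by positivity)).trans_eq ?_)
  rw [show 3 * (r * r) = r * r + 2 * (r * r) by ring, pow_add]
  ring

/-! ### Decoders -/

theorem shift_inv_apply {n : ℕ} (d i : ZMod n) : (shift d)⁻¹ i = i - d := by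
  rw [Equiv.Perm.inv_eq_iff_eq]
  simp [shift]

theorem transform_shift_inv_transform_shift {n r : ℕ} (d e : ZMod n) (z : Sequence n r) :
    transform (shift e)⁻¹ (transform (shift d) z) = transform (shift (d - e)) z := by
  funext i
  simp only [transform, shift_inv_apply]
  simp only [shift, Equiv.coe_addRight]
  congr 1
  ring

theorem transform_shift_transform_shift_inv {n r : ℕ} (d e : ZMod n) (y : Sequence n r) :
    transform (shift (d - e)) (transform (shift d)⁻¹ y) = transform (shift e)⁻¹ y := by
  funext i
  simp only [transform, shift_inv_apply]
  simp only [shift, Equiv.coe_addRight]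
  congr 1
  ring

theorem transform_shift_transform_inv_self {n r : ℕ} (d : ZMod n) (y : Sequence n r) :
    transform (shift d) (transform (shift d)⁻¹ y) = y := by
  funext i
  simp [transform]

section Decoders

variable {n r : ℕ} [NeZero n] {P : Fin r → ℝ} {W : Fin r → Fin r → ℝ} {D : Finset (ZMod n)}

theorem sum_eq_sum_transform (d : ZMod n) (f : Sequence n r → ℝ) :
    ∑ z, f z = ∑ y, f (transform (shift d)⁻¹ y) :=
  (((shift d).arrowCongr (Equiv.refl (Fin r))).sum_comp f).symm

theorem card_mul_errorProb (hD : D.Nonempty) (Φ : Decoder n r) :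
    (D.card : ℝ) * errorProb P W D Φ =
      ∑ d ∈ D, ∑ x : Sequence n r, ∑ z : Sequence n r,
        sourceProb P x * channelProb W x z * if Φ x (transform (shift d) z) ≠ d then 1 else 0 := by
  have : (D.card : ℝ) ≠ 0 := Nat.cast_ne_zero.2 hD.card_pos.ne'
  rw [errorProb, ← Finset.mul_sum, ← mul_assoc, mul_one_div_cancel this, one_mul]

/-- The error probability in terms of the likelihoods of the possible delays, given the source
sequence and the received sequence. -/
theorem card_mul_errorProb_eq_sum_likelihood (hD : D.Nonempty) (Φ : Decoder n r) :
    (D.card : ℝ) * errorProb P W D Φ =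
      ∑ x : Sequence n r, ∑ y : Sequence n r, sourceProb P x *
        ∑ d ∈ D, if Φ x y ≠ d then channelProb W x (transform (shift d)⁻¹ y) else 0 := by
  rw [card_mul_errorProb hD, Finset.sum_comm]
  refine Finset.sum_congr rfl fun x _ => ?_
  simp only [Finset.mul_sum]
  rw [Finset.sum_comm (s := Finset.univ)]
  refine Finset.sum_congr rfl fun d _ => ?_
  rw [sum_eq_sum_transform d]
  refine Finset.sum_congr rfl fun y _ => ?_
  rw [transform_shift_transform_inv_self]
  split_ifs <;> simp

theorem sum_ite_ne_likelihood {Φ : Decoder n r} (x y : Sequence n r) (h : Φ x y ∈ D) :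
    (∑ d ∈ D, if Φ x y ≠ d then channelProb W x (transform (shift d)⁻¹ y) else 0) =
      ∑ d ∈ D, channelProb W x (transform (shift d)⁻¹ y) -
        channelProb W x (transform (shift (Φ x y))⁻¹ y) := by
  rw [eq_sub_iff_add_eq, ← Finset.sum_erase_add _ _ h, ← Finset.sum_erase_add D _ h]
  simp only [ne_eq, not_true_eq_false, if_false, add_zero, add_left_inj]
  exact Finset.sum_congr rfl fun d hd => if_pos (Finset.ne_of_mem_erase hd).symm

theorem errorProb_le_of_isML (hD : D.Nonempty) (hP : ∀ a, 0 ≤ P a) {ΦML Φ : Decoder n r}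
    (hML : IsML W D ΦML) (hΦ : ∀ x y, Φ x y ∈ D) :
    errorProb P W D ΦML ≤ errorProb P W D Φ := by
  have hc : 0 < (D.card : ℝ) := Nat.cast_pos.2 hD.card_pos
  refine le_of_mul_le_mul_left ?_ hc
  rw [card_mul_errorProb_eq_sum_likelihood hD, card_mul_errorProb_eq_sum_likelihood hD]
  refine Finset.sum_le_sum fun x _ => Finset.sum_le_sum fun y _ =>
    mul_le_mul_of_nonneg_left ?_ (sourceProb_nonneg hP x)
  rw [sum_ite_ne_likelihood x y (hML x y).1, sum_ite_ne_likelihood x y (hΦ x y)]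
  exact sub_le_sub_left ((hML x y).2 _ (hΦ x y)) _

theorem errorProb_eq_of_subsingleton [Subsingleton (Fin r)] (hD : D.Nonempty)
    {Φ Φ' : Decoder n r} (hΦ : ∀ x y, Φ x y ∈ D) (hΦ' : ∀ x y, Φ' x y ∈ D) :
    errorProb P W D Φ = errorProb P W D Φ' := by
  have hc : (D.card : ℝ) ≠ 0 := Nat.cast_ne_zero.2 hD.card_pos.ne'
  refine mul_left_cancel₀ hc ?_
  rw [card_mul_errorProb_eq_sum_likelihood hD, card_mul_errorProb_eq_sum_likelihood hD]
  refine Finset.sum_congr rfl fun x _ => Finset.sum_congr rfl fun y _ => ?_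
  rw [sum_ite_ne_likelihood x y (hΦ x y), sum_ite_ne_likelihood x y (hΦ' x y),
    Subsingleton.elim (transform (shift (Φ x y))⁻¹ y) (transform (shift (Φ' x y))⁻¹ y)]

/-- Constant sequences carry no information on the delay, so every decoder errs on them. -/
theorem errorProb_pos (hD : D.Nontrivial) (hP : P ∈ stdSimplex ℝ (Fin r))
    (hW : ∀ a, W a ∈ stdSimplex ℝ (Fin r)) (Φ : Decoder n r) : 0 < errorProb P W D Φ := by
  have hpos : ∀ p ∈ stdSimplex ℝ (Fin r), ∃ a, 0 < p a := by
    intro p hp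
    by_contra! h
    have := Finset.sum_nonpos fun a (_ : a ∈ Finset.univ) => h a
    rw [hp.2] at this
    linarith
  obtain ⟨a, ha⟩ := hpos P hP
  obtain ⟨b, hb⟩ := hpos (W a) (hW a)
  obtain ⟨d, hd, hne⟩ := hD.exists_ne (Φ (fun _ => a) fun _ => b)
  have hc : 0 < (D.card : ℝ) := Nat.cast_pos.2 hD.nonempty.card_pos
  refine pos_of_mul_pos_right ?_ hc.le
  rw [card_mul_errorProb hD.nonempty]
  have h0 : ∀ (d : ZMod n) (x z : Sequence n r), 0 ≤ sourceProb P x * channelProb W x z *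
      if Φ x (transform (shift d) z) ≠ d then (1 : ℝ) else 0 := fun d x z =>
    mul_nonneg (mul_nonneg (sourceProb_nonneg hP.1 x)
      (channelProb_nonneg (fun a => (hW a).1) x z)) (by split_ifs <;> norm_num)
  refine Finset.sum_pos' (fun d _ => Finset.sum_nonneg fun x _ => Finset.sum_nonneg fun z _ =>
    h0 d x z) ⟨d, hd, Finset.sum_pos' (fun x _ => Finset.sum_nonneg fun z _ => h0 d x z)
      ⟨fun _ => a, Finset.mem_univ _, Finset.sum_pos' (fun z _ => h0 d _ z)
        ⟨fun _ => b, Finset.mem_univ _, ?_⟩⟩⟩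
  rw [if_pos (show Φ (fun _ => a) (transform (shift d) fun _ => b) ≠ d from hne.symm), mul_one]
  exact mul_pos (Finset.prod_pos fun _ _ => ha) (Finset.prod_pos fun _ _ => hb)

/-- No decoder beats the overlap of the likelihoods of any two possible delays. -/
theorem sum_overlap_le (hP : ∀ a, 0 ≤ P a) (hW : ∀ a b, 0 ≤ W a b) {d e : ZMod n} (hd : d ∈ D)
    (he : e ∈ D) (hde : d ≠ e) (Φ : Decoder n r) :
    ∑ x : Sequence n r, ∑ z : Sequence n r, sourceProb P x *
        min (channelProb W x z) (channelProb W x (transform (shift (d - e)) z)) ≤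
      (D.card : ℝ) * errorProb P W D Φ := by
  rw [card_mul_errorProb_eq_sum_likelihood ⟨d, hd⟩]
  refine Finset.sum_le_sum fun x _ => ?_
  rw [sum_eq_sum_transform d]
  refine Finset.sum_le_sum fun y _ => mul_le_mul_of_nonneg_left ?_ (sourceProb_nonneg hP x)
  rw [transform_shift_transform_shift_inv]
  have key : ∀ c ∈ D, Φ x y ≠ c → channelProb W x (transform (shift c)⁻¹ y) ≤
      ∑ d ∈ D, if Φ x y ≠ d then channelProb W x (transform (shift d)⁻¹ y) else 0 := by
    intro c hc hne
    refine le_trans (le_of_eq (if_pos hne).symm) (Finset.single_le_sum (f := fun d =>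
      if Φ x y ≠ d then channelProb W x (transform (shift d)⁻¹ y) else 0) (fun d _ => ?_) hc)
    split_ifs
    · exact channelProb_nonneg hW _ _
    · exact le_rfl
  by_cases h : Φ x y = d
  · exact (min_le_right _ _).trans (key e he (h ▸ hde))
  · exact (min_le_left _ _).trans (key d hd h)

/-- The max mutual information decoder is nearly as good as any other: union bound over the pairs of
delays, with the comparison `sum_confusion_le` for each of them. -/
theorem errorProb_MMI_le (hD : D.Nonempty) (hP : ∀ a, 0 ≤ P a) (hW : ∀ a b, 0 ≤ W a b)
    (hr : 1 ≤ r) {ΦMMI : Decoder n r} (hMMI : IsMMI D ΦMMI) (Φ : Decoder n r) :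
    errorProb P W D ΦMMI ≤ (n : ℝ) ^ 2 *
      (((n : ℝ) + 1) ^ (3 * (r * r)) * (r : ℝ) ^ maxCycles D) * errorProb P W D Φ := by
  have hc : 0 < (D.card : ℝ) := Nat.cast_pos.2 hD.card_pos
  have hcn : (D.card : ℝ) ≤ n := by
    exact_mod_cast (Finset.card_le_univ D).trans_eq (ZMod.card n)
  have hr' : (1 : ℝ) ≤ r := by exact_mod_cast hr
  set F : ℝ := ((n : ℝ) + 1) ^ (3 * (r * r)) * (r : ℝ) ^ maxCycles D with hF
  have hF0 : 0 ≤ F := by positivity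
  have hE : 0 ≤ errorProb P W D Φ := by
    refine Finset.sum_nonneg fun d _ => mul_nonneg (by positivity) (Finset.sum_nonneg fun x _ =>
      Finset.sum_nonneg fun z _ => mul_nonneg (mul_nonneg (sourceProb_nonneg hP x)
      (channelProb_nonneg hW x z)) (by split_ifs <;> norm_num))
  have hPW : ∀ x z : Sequence n r, 0 ≤ sourceProb P x * channelProb W x z := fun x z =>
    mul_nonneg (sourceProb_nonneg hP x) (channelProb_nonneg hW x z)
  have hpair : ∀ d ∈ D, ∀ e ∈ D.erase d, (∑ x : Sequence n r, ∑ z : Sequence n r,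
      if empiricalMI x z ≤ empiricalMI x (transform (shift (d - e)) z) then
        sourceProb P x * channelProb W x z else 0) ≤
      F * ((D.card : ℝ) * errorProb P W D Φ) := by
    intro d hd e he
    obtain ⟨hne, he⟩ := Finset.mem_erase.1 he
    refine (sum_confusion_le hP hW (d - e)).trans ?_
    refine mul_le_mul ?_ (sum_overlap_le hP hW hd he hne.symm Φ) ?_ hF0
    · exact mul_le_mul_of_nonneg_left (pow_le_pow_right₀ hr'
        (numCycles_shift_sub_le_maxCycles hd he hne.symm)) (by positivity)
    · exact Finset.sum_nonneg fun x _ => Finset.sum_nonneg fun z _ => mul_nonneg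
        (sourceProb_nonneg hP x) (le_min (channelProb_nonneg hW _ _) (channelProb_nonneg hW _ _))
  have hunion : (D.card : ℝ) * errorProb P W D ΦMMI ≤ ∑ d ∈ D, ∑ e ∈ D.erase d,
      ∑ x : Sequence n r, ∑ z : Sequence n r,
      if empiricalMI x z ≤ empiricalMI x (transform (shift (d - e)) z) then
        sourceProb P x * channelProb W x z else 0 := by
    rw [card_mul_errorProb hD]
    refine Finset.sum_le_sum fun d hd => ?_
    rw [Finset.sum_comm (s := D.erase d)]
    refine Finset.sum_le_sum fun x _ => ?_
    rw [Finset.sum_comm (s := D.erase d)]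
    refine Finset.sum_le_sum fun z _ => ?_
    have h0 : ∀ e : ZMod n, 0 ≤
        if empiricalMI x z ≤ empiricalMI x (transform (shift (d - e)) z) then
        sourceProb P x * channelProb W x z else 0 := by
      intro e
      split_ifs
      · exact hPW x z
      · exact le_rfl
    by_cases h : ΦMMI x (transform (shift d) z) = d
    · rw [if_neg (not_not.2 h), mul_zero]
      exact Finset.sum_nonneg fun e _ => h0 e
    · have hm := hMMI x (transform (shift d) z)
      have hle := hm.2 d hd
      rw [transform_shift_inv_transform_shift, transform_shift_inv_transform_shift, sub_self] at hle
      have hz : transform (shift 0) z = z := by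
        funext i
        simp [transform, shift]
      rw [hz] at hle
      rw [if_pos h, mul_one]
      refine le_trans (le_of_eq (if_pos hle).symm) (Finset.single_le_sum (f := fun e =>
        if empiricalMI x z ≤ empiricalMI x (transform (shift (d - e)) z) then
        sourceProb P x * channelProb W x z else 0) (fun e _ => h0 e)
        (Finset.mem_erase.2 ⟨h, hm.1⟩))
  have hX : 0 ≤ F * ((D.card : ℝ) * errorProb P W D Φ) := by positivity
  have hbound : (D.card : ℝ) * errorProb P W D ΦMMI ≤
      D.card * ((D.card : ℝ) * (F * ((D.card : ℝ) * errorProb P W D Φ))) := by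
    refine hunion.trans ?_
    rw [← nsmul_eq_mul]
    refine Finset.sum_le_card_nsmul _ _ _ fun d hd => ?_
    refine (Finset.sum_le_card_nsmul _ _ _ (hpair d hd)).trans ?_
    rw [nsmul_eq_mul]
    exact mul_le_mul_of_nonneg_right (by exact_mod_cast Finset.card_erase_le) hX
  refine (le_of_mul_le_mul_left hbound hc).trans ?_
  calc _ = (D.card : ℝ) ^ 2 * F * errorProb P W D Φ := by ring
    _ ≤ _ := by gcongr

end Decoders

/-! ### Logarithmic estimates -/

theorem one_le_logb_two {t : ℝ} (ht : 2 ≤ t) : 1 ≤ Real.logb 2 t := by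
  rw [Real.le_logb_iff_rpow_le (by norm_num) (by linarith)]
  simpa using ht

/-- Bernoulli's inequality `1 + n ≤ (1 + n / k) ^ k` in logarithmic form. -/
theorem logb_one_add_le_mul_logb {n k : ℝ} (hk : 1 ≤ k) (hn : 0 ≤ n) :
    Real.logb 2 (1 + n) ≤ k * Real.logb 2 (1 + n / k) := by
  have hk0 : 0 < k := by linarith
  have h0 : 0 ≤ n / k := by positivity
  rw [← Real.logb_rpow_eq_mul_logb_of_pos (by linarith)]
  refine Real.logb_le_logb_of_le (by norm_num) (by linarith) ?_
  have := one_add_mul_self_le_rpow_one_add (s := n / k) (by linarith) hk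
  rwa [mul_div_cancel₀ _ hk0.ne'] at this

end DelayEstimation

open DelayEstimation in
theorem mainTheorem6 (r : ℕ) :
    ∃ C : ℝ, 0 < C ∧
      ∀ (n : ℕ) [NeZero n] (D : Finset (ZMod n)) (_hD : D.Nontrivial)
        (P : Fin r → ℝ) (_hP : P ∈ stdSimplex ℝ (Fin r))
        (W : Fin r → Fin r → ℝ) (_hW : ∀ a, W a ∈ stdSimplex ℝ (Fin r))
        (ΦMMI ΦML : Decoder n r) (_hMMI : IsMMI D ΦMMI) (_hML : IsML W D ΦML)
        (κ : ℕ) (_hκ : κ = maxCycles D),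
        0 < errorProb P W D ΦMMI ∧
        0 < errorProb P W D ΦML ∧
        0 ≤ (1 / (n : ℝ)) *
            (Real.logb 2 (errorProb P W D ΦMMI) - Real.logb 2 (errorProb P W D ΦML)) ∧
        (1 / (n : ℝ)) *
            (Real.logb 2 (errorProb P W D ΦMMI) - Real.logb 2 (errorProb P W D ΦML)) ≤
          ((κ : ℝ) / n) * ((r : ℝ) ^ 2 * ((r : ℝ) + 2)) * Real.logb 2 (1 + (n : ℝ) / κ) +
            (r : ℝ) ^ 3 * (Real.logb 2 (1 + (n : ℝ)) / n) +
            (1 / (n : ℝ)) * Real.logb 2 (κ : ℝ) ∧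
        (1 / (n : ℝ)) *
            (Real.logb 2 (errorProb P W D ΦMMI) - Real.logb 2 (errorProb P W D ΦML)) ≤
          C * ((κ : ℝ) * Real.logb 2 (n : ℝ) / n) := by
  refine ⟨2 * ((r : ℝ) ^ 2 * ((r : ℝ) + 2)) + 2 * (r : ℝ) ^ 3 + 1, by positivity, ?_⟩
  intro n _ D hD P hP W hW ΦMMI ΦML hMMI hML κ hκ
  have hW0 : ∀ a b, 0 ≤ W a b := fun a => (hW a).1
  have hpos := errorProb_pos hD hP hW
  have hr1 : 1 ≤ r := by
    rcases Nat.eq_zero_or_pos r with rfl | h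
    · simpa using hP.2
    · exact h
  have hrR : (1 : ℝ) ≤ r := by exact_mod_cast hr1
  have hn2 : (2 : ℝ) ≤ n := by
    have h := (Finset.one_lt_card_iff_nontrivial.2 hD).trans_le (Finset.card_le_univ D)
    rw [ZMod.card] at h
    exact_mod_cast h
  have hk1 : (1 : ℝ) ≤ κ := by rw [hκ]; exact_mod_cast one_le_maxCycles hD
  have hkn : (κ : ℝ) ≤ n := by rw [hκ]; exact_mod_cast maxCycles_le D
  have hn0 : (0 : ℝ) < n := by linarith
  have hk0 : (0 : ℝ) < κ := by linarith
  set a := Real.logb 2 (1 + (n : ℝ)) with ha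
  set b := Real.logb 2 (1 + (n : ℝ) / κ) with hb
  set g := Real.logb 2 (errorProb P W D ΦMMI) - Real.logb 2 (errorProb P W D ΦML) with hg
  have hab : a ≤ κ * b := logb_one_add_le_mul_logb hk1 hn0.le
  have ha1 : 1 ≤ a := one_le_logb_two (by linarith)
  have hb1 : 1 ≤ b := by
    refine one_le_logb_two ?_
    have : 1 ≤ (n : ℝ) / κ := (one_le_div hk0).2 hkn
    linarith
  have hba : b ≤ a := by
    refine Real.logb_le_logb_of_le (by norm_num) (by positivity) ?_
    have := div_le_self hn0.le hk1
    linarith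
  have hlk : 0 ≤ Real.logb 2 (κ : ℝ) := Real.logb_nonneg (by norm_num) hk1
  have hg0 : 0 ≤ g := sub_nonneg.2 (Real.logb_le_logb_of_le (by norm_num) (hpos _)
    (errorProb_le_of_isML hD.nonempty hP.1 hML fun x y => (hMMI x y).1))
  have hmain : g ≤ (r : ℝ) ^ 2 * ((r : ℝ) + 2) * (κ * b) + (r : ℝ) ^ 3 * a +
      Real.logb 2 (κ : ℝ) := by
    -- For `r = 1` the general estimate is too weak, but all decoders are equally good.
    rcases hr1.eq_or_lt with rfl | hr2
    · have : g = 0 := by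
        rw [hg, errorProb_eq_of_subsingleton hD.nonempty (fun x y => (hMMI x y).1)
          fun x y => (hML x y).1, sub_self]
      rw [this]
      positivity
    · have hr2R : (2 : ℝ) ≤ r := by exact_mod_cast hr2
      have h := Real.logb_le_logb_of_le (b := 2) (by norm_num) (hpos ΦMMI)
        (errorProb_MMI_le hD.nonempty hP.1 hW0 hr1 hMMI ΦML)
      rw [← hκ, Real.logb_mul (by positivity) (hpos _).ne', Real.logb_mul (by positivity)
        (by positivity), Real.logb_mul (by positivity) (by positivity), Real.logb_pow,
        Real.logb_pow, Real.logb_pow, add_comm (n : ℝ) 1, ← ha] at h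
      push_cast at h
      have hlr : Real.logb 2 (r : ℝ) ≤ r := by
        rw [Real.logb_le_iff_le_rpow (by norm_num) (by linarith), Real.rpow_natCast]
        exact_mod_cast Nat.lt_two_pow_self.le
      have hln : Real.logb 2 (n : ℝ) ≤ a :=
        Real.logb_le_logb_of_le (by norm_num) hn0 (by linarith)
      have hkr : κ * Real.logb 2 (r : ℝ) ≤ r * (κ * b) := by
        nlinarith [mul_le_mul_of_nonneg_left hlr hk0.le,
          mul_le_mul_of_nonneg_left hb1 (mul_nonneg hk0.le (by linarith : (0 : ℝ) ≤ r))]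
      have hg1 : g ≤ 2 * a + 3 * (r * r) * a + r * (κ * b) := by
        rw [hg]; linarith
      have hB : 0 ≤ κ * b := by positivity
      have e1 : 2 * (r : ℝ) ^ 2 * a ≤ (r : ℝ) ^ 3 * a := by
        refine mul_le_mul_of_nonneg_right ?_ (by linarith)
        nlinarith [sq_nonneg (r : ℝ)]
      have e2 : ((r : ℝ) ^ 2 + 2) * a ≤ ((r : ℝ) ^ 2 + 2) * (κ * b) :=
        mul_le_mul_of_nonneg_left hab (by positivity)
      have e3 : ((r : ℝ) ^ 2 + 2 + r) * (κ * b) ≤ (r : ℝ) ^ 2 * ((r : ℝ) + 2) * (κ * b) := by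
        refine mul_le_mul_of_nonneg_right ?_ hB
        nlinarith [sq_nonneg (r : ℝ), mul_nonneg (sub_nonneg.2 hr2R) (sub_nonneg.2 hr2R)]
      linarith
  have hfirst : (1 / (n : ℝ)) * g ≤
      ((κ : ℝ) / n) * ((r : ℝ) ^ 2 * ((r : ℝ) + 2)) * b + (r : ℝ) ^ 3 * (a / n) +
        (1 / (n : ℝ)) * Real.logb 2 (κ : ℝ) := by
    refine (mul_le_mul_of_nonneg_left hmain (by positivity)).trans_eq ?_
    ring
  refine ⟨hpos _, hpos _, by positivity, hfirst, ?_⟩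
  have hl1 : 1 ≤ Real.logb 2 (n : ℝ) := one_le_logb_two hn2
  have hal : a ≤ 2 * Real.logb 2 (n : ℝ) := by
    rw [← Nat.cast_two, ← Real.logb_pow]
    push_cast
    exact Real.logb_le_logb_of_le (by norm_num) (by linarith) (by nlinarith)
  have hkl : Real.logb 2 (κ : ℝ) ≤ Real.logb 2 (n : ℝ) :=
    Real.logb_le_logb_of_le (by norm_num) hk0 hkn
  set l := Real.logb 2 (n : ℝ) with hl
  have hlκ : l ≤ κ * l := le_mul_of_one_le_left (by linarith) hk1
  have hfinal : g ≤ (2 * ((r : ℝ) ^ 2 * ((r : ℝ) + 2)) + 2 * (r : ℝ) ^ 3 + 1) * (κ * l) := by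
    have e1 : (r : ℝ) ^ 2 * ((r : ℝ) + 2) * (κ * b) ≤
        (r : ℝ) ^ 2 * ((r : ℝ) + 2) * (κ * (2 * l)) := by gcongr; linarith
    have e2 : (r : ℝ) ^ 3 * a ≤ (r : ℝ) ^ 3 * (2 * (κ * l)) := by gcongr; linarith
    linarith
  refine (mul_le_mul_of_nonneg_left hfinal (by positivity)).trans_eq ?_
  ring
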